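/- **Setting.** Let $V$ be a finite set. A *PDAG* on $V$ is a simple graph with directed edges $a\to b$ and undirected edges $a - b$ (no loops, at most one edge between two vertices) without directed cycles; a *DAG* is a PDAG without undirected edges. The *skeleton* of a PDAG is obtained by forgetting directions; a *v-structure* is $a\to b\leftarrow c$ with $a\ne c$ not adjacent. An *MPDAG* is a PDAG $\mathcal G$ such that (i) for every connected component $C$ of its undirected part, the skeleton of the subgraph induced on $C$ is chordal, and (ii) none of the following occurs as an induced subgraph: $a\to b - c$ with $a,c$ not adjacent; $a\to b\to c$ with $a - c$; $a - b,\ a - c,\ a - d,\ c\to b\leftarrow d$ with $c,d$ not adjacent; $a - b,\ a - c,\ a - d,\ d\to c\to b$ with $b,d$ not adjacent. A DAG is *represented* by $\mathcal G$ if it arises from $\mathcal G$ by orienting the undirected edges without introducing directed cycles or v-structures. For each $v\in V$ let $\mathcal X_v$ be a measurable space with at least two points whose singletons are measurable, $\mathcal X=\prod_v\mathcal X_v$. A potential outcome schedule is a random family $X(\cdot)=(X_v(x_I): v\in V,\ I\subseteq V,\ x_I\in\prod_{i\in I}\mathcal X_i)$, with values in the product space with the product $\sigma$-algebra. For a DAG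 $\mathcal D$ with parent sets $\mathrm{Pa}_{\mathcal D}(v)$, the causal model $\mathcal M(\mathcal D)$ is the set of laws $P$ of $X(\cdot)$ such that, for all $x\in\mathcal X$: (a) for disjoint $I,J\subseteq V$, almost surely, $X_J(x_I)=x_J$ implies $X(x_I,x_J)=X(x_I)$; (b) $X_v(x_I)=X_v(x_{I\cap \mathrm{Pa}_{\mathcal D}(v)})$ almost surely, for all $v\in V$, $I\subseteq V$; (c) the variables $X_v(x_{\mathrm{Pa}_{\mathcal D}(v)})$, $v\in V$, are mutually independent. For an MPDAG $\mathcal G$ let $\mathcal M(\mathcal G)$ be the union of $\mathcal M(\mathcal D)$ over the DAGs $\mathcal D$ represented by $\mathcal G$. The MPDAGs on $V$ are ordered by $\mathcal G_1\preceq\mathcal G_2 :\iff \mathcal M(\mathcal G_1)\subseteq\mathcal M(\mathcal G_2)$; $\mathcal G_2$ *covers* $\mathcal G_1$ if $\mathcal M(\mathcal G_1)\subsetneq\mathcal M(\mathcal G_2)$ and no MPDAG has a model strictly between these two. **Proposition 4.9.** If $|V|\ge 3$, the model-oriented poset of causal MPDAGs on $V$ is not graded: there is no function $\mathrm{rank}$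 from the MPDAGs on $V$ to the integers such that $\mathrm{rank}(\mathcal G_2)=\mathrm{rank}(\mathcal G_1)+1$ whenever $\mathcal G_2$ covers $\mathcal G_1$. If moreover $|V|\ge 4$, there are MPDAGs $\mathcal G_s,\mathcal G_t$ on $V$ and two maximal chains from $\mathcal G_s$ to $\mathcal G_t$ (sequences in which each graph covers the preceding one), one of length $3$ and one of length $5$. -/

import Mathlib

open MeasureTheory ProbabilityTheory

namespace CausalGraph

universe u w

/-! ### Partially directed acyclic graphs -/

/-- A partially directed acyclic graph (PDAG) on `V`: a simple graph with directed edges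
`dir a b` (read `a → b`) and undirected edges `undir.Adj a b` (read `a - b`), at most one edge
between two vertices, no self-loop and no directed cycle.  Acyclicity excludes directed loops
and pairs of opposite directed edges. -/
@[ext]
structure PDAG (V : Type u) where
  dir : V → V → Prop
  undir : SimpleGraph V
  simple : ∀ a b, dir a b → ¬ undir.Adj a b
  acyclic : ∀ a, ¬ Relation.TransGen dir a a

/-- A simple graph is chordal if every cycle of length at least four has a chord, that is, an edge
of the graph that joins two vertices of the cycle and is not an edge of the cycle. -/
def IsChordal {V : Type u} (H : SimpleGraph V) : Prop :=
  ∀ (v : V) (c : H.Walk v v), c.IsCycle → 4 ≤ c.length →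
    ∃ a ∈ c.support, ∃ b ∈ c.support, H.Adj a b ∧ s(a, b) ∉ c.edges

namespace PDAG

variable {V : Type u} (G : PDAG V)

/-- The skeleton: all edges, with their directions ignored. -/
def skeleton : SimpleGraph V where
  Adj a b := G.dir a b ∨ G.dir b a ∨ G.undir.Adj a b
  symm := ⟨by
    rintro a b (h | h | h)
    · exact Or.inr (Or.inl h)
    · exact Or.inl h
    · exact Or.inr (Or.inr h.symm)⟩
  loopless := ⟨by
    rintro a (h | h | h)
    · exact G.acyclic a (Relation.TransGen.single h)
    · exact G.acyclic a (Relation.TransGen.single h)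
    · exact G.undir.loopless.irrefl a h⟩

/-- A DAG is a PDAG with directed edges only. -/
def IsDAG : Prop := G.undir = ⊥

/-- The set of parents of a vertex. -/
def parents (v : V) : Set V := {a | G.dir a v}

/-- `a → b ← c` is a v-structure: `a` and `c` are distinct and not adjacent. -/
def VStructure (a b c : V) : Prop :=
  G.dir a b ∧ G.dir c b ∧ a ≠ c ∧ ¬ G.skeleton.Adj a c

/-- `a → b - c` with `a`, `c` not adjacent (first forbidden induced subgraph). -/
def Forbidden₁ : Prop :=
  ∃ a b c, G.dir a b ∧ G.undir.Adj b c ∧ a ≠ c ∧ ¬ G.skeleton.Adj a c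

/-- `a → b → c` with `a - c` (second forbidden induced subgraph). -/
def Forbidden₂ : Prop :=
  ∃ a b c, G.dir a b ∧ G.dir b c ∧ G.undir.Adj a c

/-- `a - b`, `a - c`, `a - d`, `c → b ← d` with `c`, `d` not adjacent
(third forbidden induced subgraph). -/
def Forbidden₃ : Prop :=
  ∃ a b c d, G.undir.Adj a b ∧ G.undir.Adj a c ∧ G.undir.Adj a d ∧
    G.dir c b ∧ G.dir d b ∧ c ≠ d ∧ ¬ G.skeleton.Adj c d

/-- `a - b`, `a - c`, `a - d`, `d → c → b` with `b`, `d` not adjacent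
(fourth forbidden induced subgraph). -/
def Forbidden₄ : Prop :=
  ∃ a b c d, G.undir.Adj a b ∧ G.undir.Adj a c ∧ G.undir.Adj a d ∧
    G.dir d c ∧ G.dir c b ∧ b ≠ d ∧ ¬ G.skeleton.Adj b d

/-- A maximally oriented PDAG (MPDAG): on every connected component of the undirected part the
induced skeleton (directed edges included) is chordal, and none of the four forbidden structures
occurs as an induced subgraph. -/
def IsMPDAG : Prop :=
  (∀ C : G.undir.ConnectedComponent, IsChordal (G.skeleton.induce C.supp)) ∧
    ¬ G.Forbidden₁ ∧ ¬ G.Forbidden₂ ∧ ¬ G.Forbidden₃ ∧ ¬ G.Forbidden₄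

/-- The DAG `D` is represented by `G`: it is obtained from `G` by orienting the undirected edges
(so it keeps the skeleton and the directed edges of `G`; acyclicity is part of `D` being a DAG)
without introducing a v-structure. -/
def Represents (D : PDAG V) : Prop :=
  D.IsDAG ∧ D.skeleton = G.skeleton ∧ (∀ a b, G.dir a b → D.dir a b) ∧
    ∀ a b c, D.VStructure a b c → G.VStructure a b c

end PDAG

/-! ### Causal models -/

/-- The realizations of a potential outcome schedule for variables `v` with values in `𝒳 v`:
for every set `I` of intervened variables, every value `x_I` imposed on them and every variable
`v`, the potential outcome `X_v(x_I)`.  It carries the product σ-algebra. -/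
abbrev Schedule {V : Type u} (𝒳 : V → Type w) : Type (max u w) :=
  (I : Set V) → ((i : I) → 𝒳 i) → (v : V) → 𝒳 v

section Models

variable {V : Type u} (𝒳 : V → Type w)

/-- The potential outcome `X_v(x_I)`, where `x_I` is the restriction of `x` to `I`. -/
def outcome {𝒳 : V → Type w} (X : Schedule 𝒳) (I : Set V) (x : (v : V) → 𝒳 v) (v : V) : 𝒳 v :=
  X I (fun i => x i) v

variable [∀ v, MeasurableSpace (𝒳 v)]

/-- Consistency of the law `P` of a potential outcome schedule: for disjoint `I`, `J` and every `x`,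
given `X_J(x_I) = x_J` the identity `X(x_I, x_J) = X(x_I)` holds with probability one. -/
def IsConsistent (P : ProbabilityMeasure (Schedule 𝒳)) : Prop :=
  ∀ I J : Set V, Disjoint I J → ∀ x : (v : V) → 𝒳 v,
    ∀ᵐ X ∂(P : Measure (Schedule 𝒳)),
      (∀ j ∈ J, outcome X I x j = x j) → ∀ v, outcome X (I ∪ J) x v = outcome X I x v

/-- `P` is causal Markov with respect to the DAG `D`: the potential outcomes of a variable depend
on the intervention only through its parents, and for every `x` the one-step-ahead
counterfactuals are mutually independent. -/
def IsCausalMarkov (D : PDAG V) (P : ProbabilityMeasure (Schedule 𝒳)) : Prop :=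
  (∀ (v : V) (I : Set V) (x : (v : V) → 𝒳 v), ∀ᵐ X ∂(P : Measure (Schedule 𝒳)),
      outcome X I x v = outcome X (I ∩ D.parents v) x v) ∧
    ∀ x : (v : V) → 𝒳 v,
      iIndepFun (fun (v : V) (X : Schedule 𝒳) => outcome X (D.parents v) x v)
        (P : Measure (Schedule 𝒳))

/-- The causal model represented by a DAG. -/
def dagModel (D : PDAG V) : Set (ProbabilityMeasure (Schedule 𝒳)) :=
  {P | IsConsistent 𝒳 P ∧ IsCausalMarkov 𝒳 D P}

/-- The causal model represented by an MPDAG: the union of the causal models of the DAGs that it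
represents. -/
def mpdagModel (G : PDAG V) : Set (ProbabilityMeasure (Schedule 𝒳)) :=
  ⋃ D ∈ {D : PDAG V | G.Represents D}, dagModel 𝒳 D

end Models

/-- The MPDAGs over `V`, seen as causal models for variables with values in `𝒳 v`. -/
def CausalMPDAG {V : Type u} (_ : V → Type w) : Type u := {G : PDAG V // G.IsMPDAG}

/-- The model-oriented order: `G₁ ≤ G₂` if and only if the causal model of `G₁` is contained in
that of `G₂`.  `G₁ < G₂` and the covering relation `G₁ ⋖ G₂` refer to strict containment of the
models, which is containment together with `G₁ ≠ G₂` whenever the model map is injective. -/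
instance {V : Type u} (𝒳 : V → Type w) [∀ v, MeasurableSpace (𝒳 v)] :
    Preorder (CausalMPDAG 𝒳) :=
  Preorder.lift fun G => mpdagModel 𝒳 G.1

end CausalGraph

namespace CausalGraph

universe u w

/-! ### Inclusion between the models of DAGs -/

section Models

variable {V : Type u} {𝒳 : V → Type w}

/-! The model order is purely combinatorial. Models of DAGs grow with the edge set, and each DAG
model contains a law in which every edge has a detectable effect, so that the law lies only in
models of DAGs containing all these edges (`exists_mem_dagModel_of_effective`). A union of DAG
models is therefore contained in another one exactly when every represented DAG is a subgraph of a
DAG represented by the other graph (`mpdagModel_subset_iff`).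

Two kinds of covers are immediate: adding an edge to a DAG (`IsDAG.coveredBy`), and turning a
directed edge into an undirected one when this gains a single DAG (`coveredBy_of_insert`,
`coveredBy_of_orient`). Gradedness fails because some covers add two edges at once (`edge_cone`,
`undirPath_paw`): an intermediate graph with just one of them would contain an unshielded collider
in some represented DAG, which fixes an orientation that has to remain free.

On three vertices, `1 → 2` reaches the cone in two covers through `1 - 2`, and in three by first
building the directed triangle. On four vertices, `0 → 1 → 3` reaches the paw in three covers by
first undirecting the path, and in five by first adding the edges. -/

/-- The causal models of DAGs are monotone in the set of directed edges. -/
theorem dagModel_mono [∀ v, MeasurableSpace (𝒳 v)] {D₁ D₂ : PDAG V} (h : D₁.dir ≤ D₂.dir) :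
    dagModel 𝒳 D₁ ⊆ dagModel 𝒳 D₂ := by
  rintro P ⟨hc, hb, hi⟩
  have hsub (v : V) : D₁.parents v ⊆ D₂.parents v := fun a ha => h a v ha
  refine ⟨hc, fun v I x => ?_, fun x => ?_⟩
  · filter_upwards [hb v I x, hb v (I ∩ D₂.parents v) x] with X h₁ h₂
    rw [h₁, h₂, Set.inter_assoc, Set.inter_eq_right.2 (hsub v)]
  · refine (hi x).congr fun v => ?_
    filter_upwards [hb v (D₂.parents v) x] with X h₁
    rw [h₁, Set.inter_eq_right.2 (hsub v)]

/-- In the model of a DAG, intervening on a vertex does not affect its non-children. -/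
theorem ae_outcome_singleton [∀ v, MeasurableSpace (𝒳 v)] {D : PDAG V}
    {P : ProbabilityMeasure (Schedule 𝒳)} (hP : P ∈ dagModel 𝒳 D) {a b : V} (hab : ¬ D.dir a b)
    (x : (v : V) → 𝒳 v) :
    ∀ᵐ X ∂(P : Measure (Schedule 𝒳)), outcome X {a} x b = outcome X ∅ x b := by
  filter_upwards [hP.2.1 b {a} x] with X hX
  rw [hX, Set.singleton_inter_eq_empty.2 (show a ∉ D.parents b from hab)]

/-- Mutual independence of random variables that factor through `Ψ` can be checked on the image
measure. -/
theorem iIndepFun_comp_iff_map {ι Ω Ω' : Type*} {β : ι → Type*} [MeasurableSpace Ω]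
    [MeasurableSpace Ω'] [∀ i, MeasurableSpace (β i)] {μ : Measure Ω} {Ψ : Ω → Ω'}
    (hΨ : Measurable Ψ) {f : (i : ι) → Ω' → β i} (hf : ∀ i, Measurable (f i)) :
    iIndepFun (fun i => f i ∘ Ψ) μ ↔ iIndepFun f (μ.map Ψ) := by
  simp only [iIndepFun_iff_measure_inter_preimage_eq_mul]
  refine forall_congr' fun S => forall_congr' fun s => forall_congr' fun hs => ?_
  rw [Measure.map_apply hΨ (S.measurableSet_biInter fun i hi => hf i (hs i hi)),
    Finset.prod_congr rfl fun i hi => Measure.map_apply hΨ (hf i (hs i hi))]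
  simp only [Set.preimage_comp, Set.preimage_iInter]

/-! ### A law in the model of a DAG in which every edge has an effect -/

/-- The choice of one of the points `z v`, `o v` by a bit. -/
def ofBit (z o : (v : V) → 𝒳 v) (v : V) (t : Bool) : 𝒳 v := if t then o v else z v

open Classical in
/-- The schedule in which every variable is a bit `u v`, except that the head of the directed edge
`e` of `D` is flipped according to the value of its tail. -/
noncomputable def flipSchedule (D : PDAG V) (z o : (v : V) → 𝒳 v) (ω : (V × V) × (V → Bool)) :
    Schedule 𝒳 := fun I y v =>
  ofBit z o v (xor (ω.2 v) (if D.dir ω.1.1 ω.1.2 ∧ v = ω.1.2 then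
    (if h : ω.1.1 ∈ I then decide (y ⟨ω.1.1, h⟩ = o ω.1.1) else ω.2 ω.1.1) else false))

open Classical in
theorem outcome_flipSchedule (D : PDAG V) (z o : (v : V) → 𝒳 v) (ω : (V × V) × (V → Bool))
    (I : Set V) (x : (v : V) → 𝒳 v) (v : V) :
    outcome (flipSchedule D z o ω) I x v =
      ofBit z o v (xor (ω.2 v) (if D.dir ω.1.1 ω.1.2 ∧ v = ω.1.2 then
        (if ω.1.1 ∈ I then decide (x ω.1.1 = o ω.1.1) else ω.2 ω.1.1) else false)) := by
  rfl

-- Only `a ∈ J \ I` is delicate. A DAG has no loop, so the tail `a` is not the flipped vertex and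
-- its outcome shows its own bit; imposing the observed value then passes the same bit to the head.
open Classical in
theorem flipSchedule_consistent (D : PDAG V) {z o : (v : V) → 𝒳 v} (hzo : ∀ v, z v ≠ o v)
    (ω : (V × V) × (V → Bool)) (I J : Set V) (x : (v : V) → 𝒳 v)
    (h : ∀ j ∈ J, outcome (flipSchedule D z o ω) I x j = x j) (v : V) :
    outcome (flipSchedule D z o ω) (I ∪ J) x v = outcome (flipSchedule D z o ω) I x v := by
  obtain ⟨⟨a, b⟩, t⟩ := ω
  simp only [outcome_flipSchedule] at h ⊢
  by_cases hab : D.dir a b ∧ v = b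
  · have hne : a ≠ b := fun e => D.acyclic a (.single (by simpa [e] using hab.1))
    by_cases hI : a ∈ I
    · simp [hI]
    by_cases hJ : a ∈ J
    · have := h a hJ
      simp only [hne, and_false, if_false, Bool.xor_false] at this
      have hbit : decide (x a = o a) = t a := by
        rw [← this]; cases t a <;> simp [ofBit, hzo]
      simp [hab, hI, hJ, hbit]
    · simp [hI, hJ]
  · simp [hab]

theorem flipSchedule_local (D : PDAG V) (z o : (v : V) → 𝒳 v)
    (ω : (V × V) × (V → Bool)) (v : V) (I : Set V) (x : (v : V) → 𝒳 v) :
    outcome (flipSchedule D z o ω) I x v =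
      outcome (flipSchedule D z o ω) (I ∩ D.parents v) x v := by
  obtain ⟨⟨a, b⟩, t⟩ := ω
  simp only [outcome_flipSchedule]
  by_cases hab : D.dir a b ∧ v = b
  · obtain ⟨hab, rfl⟩ := hab
    have h : a ∈ I ∩ D.parents v ↔ a ∈ I := and_iff_left hab
    by_cases hI : a ∈ I
    · simp [hI, h.2 hI]
    · simp [hI, mt h.1 hI]
  · simp [hab]

/-- A fair coin. -/
noncomputable def coin : Measure Bool := (PMF.uniformOfFintype Bool).toMeasure

instance : IsProbabilityMeasure coin := by unfold coin; infer_instance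

theorem coin_singleton (t : Bool) : coin {t} = 2⁻¹ := by
  simp [coin]

theorem coin_map_xor (s : Bool) : coin.map (fun t => xor t s) = coin := by
  refine Measure.ext_of_singleton fun t => ?_
  have : (fun t => xor t s) ⁻¹' {t} = {xor t s} := by
    ext r; cases r <;> cases s <;> cases t <;> simp
  rw [Measure.map_apply .of_discrete (.singleton t), this, coin_singleton, coin_singleton]

variable [Fintype V]

theorem pi_coin_map_xor (s : V → Bool) :
    (Measure.pi fun _ : V => coin).map (fun t v => xor (t v) (s v)) =
      Measure.pi fun _ : V => coin := by
  have := Measure.pi_map_pi (μ := fun _ : V => coin) (f := fun v t => xor t (s v))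
    (hμ := fun v => by rw [coin_map_xor]; infer_instance)
    fun v => Measurable.of_discrete.aemeasurable
  rw [this]
  simp only [coin_map_xor]

/-- Every DAG model contains a law that belongs to the models of no DAGs other than the DAGs with at
least the same edges. -/
theorem exists_mem_dagModel_of_effective [Nonempty V] [∀ v, MeasurableSpace (𝒳 v)]
    [∀ v, MeasurableSingletonClass (𝒳 v)] [∀ v, Nontrivial (𝒳 v)] (D : PDAG V) :
    ∃ P ∈ dagModel 𝒳 D, ∀ D' : PDAG V, P ∈ dagModel 𝒳 D' → D.dir ≤ D'.dir := by
  classical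
  choose z o hzo using fun v => exists_pair_ne (𝒳 v)
  let _ : MeasurableSpace V := ⊤
  have : DiscreteMeasurableSpace V := ⟨fun _ => trivial⟩
  let ν : Measure (V × V) := (PMF.uniformOfFintype (V × V)).toMeasure
  let κ : Measure (V → Bool) := Measure.pi fun _ => coin
  let μ : Measure ((V × V) × (V → Bool)) := ν.prod κ
  have hX : Measurable (flipSchedule D z o) := .of_discrete
  have hout (I : Set V) (x : (v : V) → 𝒳 v) (v : V) :
      Measurable fun X : Schedule 𝒳 => outcome X I x v := by
    unfold outcome
    exact (measurable_pi_apply v).comp ((measurable_pi_apply _).comp (measurable_pi_apply I))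
  have : IsProbabilityMeasure μ := by infer_instance
  let P : ProbabilityMeasure (Schedule 𝒳) :=
    ⟨μ.map (flipSchedule D z o), Measure.isProbabilityMeasure_map hX.aemeasurable⟩
  -- For fixed `x` only finitely many outcomes are compared, which makes this event measurable;
  -- equality of entire schedules need not be.
  have hae (x : (v : V) → 𝒳 v) : ∀ᵐ X ∂(P : Measure (Schedule 𝒳)),
      ∃ ω, ∀ (I : Set V) (v : V), outcome X I x v = outcome (flipSchedule D z o ω) I x v := by
    refine (ae_map_iff hX.aemeasurable ?_).2 (.of_forall fun ω => ⟨ω, fun _ _ => rfl⟩)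
    simp only [Set.ofPred_exists, Set.ofPred_forall]
    exact .iUnion fun ω => .iInter fun I => .iInter fun v => hout I x v (.singleton _)
  refine ⟨P, ⟨fun I J _ x => ?_, fun v I x => ?_, fun x => ?_⟩, fun D' hD' a b hab => ?_⟩
  · filter_upwards [hae x] with X ⟨ω, hω⟩
    simp only [hω]
    exact flipSchedule_consistent D hzo ω I J x
  · filter_upwards [hae x] with X ⟨ω, hω⟩
    rw [hω, hω, ← flipSchedule_local]
  · refine (iIndepFun_comp_iff_map hX fun v => hout (D.parents v) x v).1 ?_
    -- Under interventions on all parents, the chosen edge `e` only adds the deterministic shift `s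
    -- e` to the bits. Fair coins are invariant under shifts, so the shifted bits have law `κ` for
    -- every `e`; the random edge shared by all variables thus creates no dependence.
    let s (e : V × V) (v : V) : Bool :=
      if D.dir e.1 e.2 ∧ v = e.2 then decide (x e.1 = o e.1) else false
    have hmp : MeasurePreserving (fun p : (V × V) × (V → Bool) => (id p.1, fun v => xor (p.2 v)
        (s p.1 v))) μ (ν.prod κ) :=
      (MeasurePreserving.id ν).skew_product
        (g := fun (e : V × V) (t : V → Bool) (v : V) => xor (t v) (s e v)) .of_discrete
        (.of_forall fun e => pi_coin_map_xor (s e))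
    have hmp' := measurePreserving_snd.comp hmp
    have hind : iIndepFun (fun (v : V) (t : V → Bool) => ofBit z o v (t v)) κ :=
      iIndepFun_pi (μ := fun _ : V => coin) (X := fun v t => ofBit z o v t)
        fun v => Measurable.of_discrete.aemeasurable
    have hκ : κ = μ.map _ := hmp'.map_eq.symm
    rw [hκ] at hind
    have := (iIndepFun_comp_iff_map hmp'.measurable
      fun v => (.of_discrete : Measurable fun t : V → Bool => ofBit z o v (t v))).2 hind
    convert this using 3 with v
    funext ω
    obtain ⟨⟨a, b⟩, t⟩ := ω
    simp only [Function.comp_apply, outcome_flipSchedule, s]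
    by_cases hab : D.dir a b ∧ v = b
    · obtain ⟨hab, rfl⟩ := hab
      simp [PDAG.parents, hab]
    · simp [hab]
  · by_contra hab'
    have h := ae_of_ae_map hX.aemeasurable (ae_outcome_singleton hD' hab' z)
    -- When the edge `(a, b)` is chosen and only `a` has bit one, the head takes the value `o b`
    -- without intervention and `z b` after imposing `z a`. This outcome has positive probability.
    let t : V → Bool := fun v => decide (v = a)
    have hpos : μ {((a, b), t)} ≠ 0 := by
      rw [← Set.singleton_prod_singleton, Measure.prod_prod, Measure.pi_singleton]
      simp [ν, coin_singleton, ENNReal.mul_eq_top]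
    obtain ⟨ω, rfl, hω⟩ := ((frequently_ae_mem_iff.2 hpos).and_eventually h).exists
    have hne : b ≠ a := fun e => D.acyclic a (.single (e ▸ hab))
    simp [outcome_flipSchedule, ofBit, hab, hne, hzo, t] at hω

/-- Inclusion of the models of MPDAGs in terms of the represented DAGs. -/
theorem mpdagModel_subset_iff [∀ v, MeasurableSpace (𝒳 v)]
    [∀ v, MeasurableSingletonClass (𝒳 v)] [∀ v, Nontrivial (𝒳 v)] [Nonempty V] {G₁ G₂ : PDAG V} :
    mpdagModel 𝒳 G₁ ⊆ mpdagModel 𝒳 G₂ ↔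
      ∀ D₁, G₁.Represents D₁ → ∃ D₂, G₂.Represents D₂ ∧ D₁.dir ≤ D₂.dir := by
  simp only [mpdagModel, Set.iUnion₂_subset_iff]
  refine ⟨fun h D₁ h₁ => ?_, fun h D₁ h₁ P hP => ?_⟩
  · obtain ⟨P, hP, hmin⟩ := exists_mem_dagModel_of_effective (𝒳 := 𝒳) D₁
    obtain ⟨D₂, h₂, hP₂⟩ := Set.mem_iUnion₂.1 (h D₁ h₁ hP)
    exact ⟨D₂, h₂, hmin D₂ hP₂⟩
  · obtain ⟨D₂, h₂, hle⟩ := h D₁ h₁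
    exact Set.mem_iUnion₂.2 ⟨D₂, h₂, dagModel_mono hle hP⟩

end Models

/-! ### Chordality from an elimination ordering -/

open SimpleGraph

/-- A graph with a perfect elimination ordering is chordal. -/
theorem isChordal_of_height {W : Type u} {H : SimpleGraph W} (h : W → ℕ)
    (hne : ∀ x y, H.Adj x y → h x ≠ h y)
    (hcl : ∀ x y z, H.Adj x z → H.Adj y z → h x < h z → h y < h z → x ≠ y → H.Adj x y) :
    IsChordal H := by
  classical
  intro v₀ c₀ hc₀ hlen₀
  -- At a highest vertex of the cycle both cycle neighbours are lower, so `hcl` joins them; this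
  -- edge is the chord.
  obtain ⟨v, hv, hmax₀⟩ := c₀.support.toFinset.exists_max_image h ⟨v₀, by simp⟩
  rw [List.mem_toFinset] at hv
  have hc := hc₀.rotate hv
  have hlen : 4 ≤ (c₀.rotate v hv).length := by simpa using hlen₀
  have hsupp (x : W) (hx : x ∈ (c₀.rotate v hv).support) : x ∈ c₀.support := by
    simpa using hx
  have hedge (e : Sym2 W) (he : e ∉ (c₀.rotate v hv).edges) : e ∉ c₀.edges := by
    simpa [(c₀.rotate_edges v hv).mem_iff] using he
  generalize c₀.rotate v hv = c at hc hlen hsupp hedge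
  have hnil : ¬ c.Nil := hc.not_nil
  have hs := c.adj_snd hnil
  have hp := c.adj_penultimate hnil
  have hlt (x : W) (hx : x ∈ c.support) (hadj : H.Adj x v) : h x < h v :=
    lt_of_le_of_ne (hmax₀ x (List.mem_toFinset.2 (hsupp x hx))) (hne x v hadj)
  have hs_mem : c.snd ∈ c.support := c.getVert_mem_support 1
  have hp_mem : c.penultimate ∈ c.support := c.getVert_mem_support _
  have hadj : H.Adj c.snd c.penultimate :=
    hcl _ _ v hs.symm hp (hlt _ hs_mem hs.symm) (hlt _ hp_mem hp) hc.snd_ne_penultimate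
  refine ⟨c.snd, hsupp _ hs_mem, c.penultimate, hsupp _ hp_mem, hadj, hedge _ fun hmem => ?_⟩
  cases c with
  | nil => simp at hnil
  | cons hvw q =>
    have hq : q.IsPath := ((Walk.cons_isCycle_iff q hvw).1 hc).1
    have hql : 3 ≤ q.length := by simpa using hlen
    have hqn : ¬ q.Nil := fun hn => by simp [Walk.length_eq_zero_iff.2 hn] at hql
    rw [Walk.penultimate_cons_of_not_nil _ _ hqn] at hmem hp
    rw [Walk.snd_cons, Walk.edges_cons, List.mem_cons] at hmem
    rcases hmem with hmem | hmem
    · rcases Sym2.eq_iff.1 hmem with ⟨e, -⟩ | ⟨-, e⟩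
      · exact hvw.ne e.symm
      · exact hp.ne e
    -- If the chord were an edge of the path `q`, the penultimate vertex of `q` would be its second
    -- one, although `q` has length at least three.
    · have he := hq.eq_snd_of_mem_edges hmem
      have := hq.getVert_injOn (by simp) (by simp; lia) he
      lia


/-! ### The model order in terms of represented DAGs -/

namespace PDAG

variable {V : Type u}

@[simp]
theorem skeleton_adj {G : PDAG V} {x y : V} :
    G.skeleton.Adj x y ↔ G.dir x y ∨ G.dir y x ∨ G.undir.Adj x y := Iff.rfl

theorem asymm {G : PDAG V} {x y : V} (h : G.dir x y) : ¬ G.dir y x := fun h' =>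
  G.acyclic x (.tail (.single h) h')

theorem no_triangle {G : PDAG V} {x y z : V} (hxy : G.dir x y) (hyz : G.dir y z) :
    ¬ G.dir z x := fun hzx =>
  G.acyclic x (.tail (.tail (.single hxy) hyz) hzx)

theorem IsDAG.skeleton_adj {D : PDAG V} (h : D.IsDAG) {x y : V} :
    D.skeleton.Adj x y ↔ D.dir x y ∨ D.dir y x := by
  have h' : D.undir = ⊥ := h
  simp [h']

theorem skeleton_mono {D₁ D₂ : PDAG V} (h₁ : D₁.IsDAG) (h : D₁.dir ≤ D₂.dir) {x y : V}
    (hxy : D₁.skeleton.Adj x y) : D₂.skeleton.Adj x y := by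
  rcases h₁.skeleton_adj.1 hxy with h' | h'
  · exact Or.inl (h _ _ h')
  · exact Or.inr (Or.inl (h _ _ h'))

/-- A reversed edge would give a 2-cycle in `D₂`. Consequently, on a fixed skeleton, domination is
inclusion of the sets of represented DAGs. -/
theorem IsDAG.eq_of_le {D₁ D₂ : PDAG V} (h₁ : D₁.IsDAG) (h₂ : D₂.IsDAG) (h : D₁.dir ≤ D₂.dir)
    (hs : ∀ x y, D₂.skeleton.Adj x y → D₁.skeleton.Adj x y) : D₁ = D₂ := by
  refine PDAG.ext (funext₂ fun x y => propext ⟨h x y, fun hxy => ?_⟩) (h₁.trans h₂.symm)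
  exact (h₁.skeleton_adj.1 (hs x y (Or.inl hxy))).resolve_right fun h' => asymm hxy (h _ _ h')

theorem Represents.skeleton_adj {G D : PDAG V} (h : G.Represents D) {x y : V} :
    G.skeleton.Adj x y ↔ D.dir x y ∨ D.dir y x := by
  rw [← h.2.1, h.1.skeleton_adj]

/-- The combinatorial form of the model order: every DAG represented by `G₁` is a subgraph of a
DAG represented by `G₂`. -/
def Dominated (G₁ G₂ : PDAG V) : Prop :=
  ∀ D₁, G₁.Represents D₁ → ∃ D₂, G₂.Represents D₂ ∧ D₁.dir ≤ D₂.dir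

/-- The combinatorial form of the covering relation of the model order. -/
def CoveredBy (G₁ G₂ : PDAG V) : Prop :=
  G₁.Dominated G₂ ∧ ¬ G₂.Dominated G₁ ∧
    ∀ G, G₁.Dominated G → G.Dominated G₂ → G.Dominated G₁ ∨ G₂.Dominated G

/-- `CoveredBy` excludes all intermediate PDAGs, which is more than the poset of MPDAGs requires. -/
theorem CoveredBy.covBy [Fintype V] [Nonempty V] {𝒳 : V → Type w} [∀ v, MeasurableSpace (𝒳 v)]
    [∀ v, MeasurableSingletonClass (𝒳 v)] [∀ v, Nontrivial (𝒳 v)] {G₁ G₂ : CausalMPDAG 𝒳}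
    (h : G₁.1.CoveredBy G₂.1) : G₁ ⋖ G₂ := by
  have hle (G H : CausalMPDAG 𝒳) : G ≤ H ↔ G.1.Dominated H.1 := mpdagModel_subset_iff
  refine ⟨lt_iff_le_not_ge.2 ⟨(hle _ _).2 h.1, mt (hle _ _).1 h.2.1⟩, fun G h₁ h₂ => ?_⟩
  rcases h.2.2 G.1 ((hle _ _).1 h₁.le) ((hle _ _).1 h₂.le) with h' | h'
  · exact h₁.not_ge ((hle _ _).2 h')
  · exact h₂.not_ge ((hle _ _).2 h')

/-- Two graphs with the same skeleton are in covering relation if the second one represents exactly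
one more DAG. -/
theorem coveredBy_of_insert {G₁ G₂ D₀ : PDAG V} (hs : G₁.skeleton = G₂.skeleton)
    (hne : ∃ D, G₁.Represents D) (hsub : ∀ D, G₁.Represents D → G₂.Represents D)
    (h₀ : G₂.Represents D₀) (h₀' : ¬ G₁.Represents D₀)
    (h : ∀ D, G₂.Represents D → G₁.Represents D ∨ D = D₀) : G₁.CoveredBy G₂ := by
  refine ⟨fun D hD => ⟨D, hsub D hD, le_rfl⟩, fun hd => ?_, fun G h₁ h₂ => ?_⟩
  · obtain ⟨D, hD, hle⟩ := hd D₀ h₀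
    have : D₀ = D := h₀.1.eq_of_le hD.1 hle fun x y hxy => by
      rwa [h₀.2.1, ← hs, ← hD.2.1]
    exact h₀' (this ▸ hD)
  -- The graph `G` is squeezed between two graphs with the same skeleton, so its set of DAGs lies
  -- between theirs, and these differ only by `D₀`.
  · have hG : ∀ x y, G.skeleton.Adj x y ↔ G₂.skeleton.Adj x y := fun x y => by
      obtain ⟨D, hD⟩ := hne
      obtain ⟨D', hD', hle⟩ := h₁ D hD
      obtain ⟨D'', hD'', hle'⟩ := h₂ D' hD'
      constructor <;> intro hxy
      · rw [← hD''.2.1]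
        exact skeleton_mono hD'.1 hle' (by rwa [hD'.2.1])
      · rw [← hD'.2.1]
        exact skeleton_mono hD.1 hle (by rwa [hD.2.1, hs])
    have hG₂ (D : PDAG V) (hD : G.Represents D) : G₂.Represents D := by
      obtain ⟨D', hD', hle⟩ := h₂ D hD
      rwa [hD.1.eq_of_le hD'.1 hle fun x y hxy => by rwa [hD.2.1, hG, ← hD'.2.1]]
    have hG₁ (D : PDAG V) (hD : G₁.Represents D) : G.Represents D := by
      obtain ⟨D', hD', hle⟩ := h₁ D hD
      rwa [hD.1.eq_of_le hD'.1 hle fun x y hxy => by rwa [hD.2.1, hs, ← hG, ← hD'.2.1]]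
    by_cases hD₀ : G.Represents D₀
    · refine .inr fun D hD => ⟨D, ?_, le_rfl⟩
      rcases h D hD with h' | rfl
      · exact hG₁ D h'
      · exact hD₀
    · refine .inl fun D hD => ⟨D, ?_, le_rfl⟩
      exact (h D (hG₂ D hD)).resolve_right fun e => hD₀ (e ▸ hD)

theorem IsDAG.represents_iff {D D' : PDAG V} (h : D.IsDAG) : D.Represents D' ↔ D' = D := by
  constructor
  · intro h'
    exact (h.eq_of_le h'.1 h'.2.2.1 fun x y hxy => by rwa [← h'.2.1]).symm
  · rintro rfl
    exact ⟨h, rfl, fun _ _ => id, fun _ _ _ => id⟩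

/-- A DAG is covered by the DAG with one more edge. -/
theorem IsDAG.coveredBy {D₁ D₂ : PDAG V} (h₁ : D₁.IsDAG) (h₂ : D₂.IsDAG) {x y : V}
    (hxy : ¬ D₁.dir x y) (h : ∀ u v, D₂.dir u v ↔ D₁.dir u v ∨ (u = x ∧ v = y)) :
    D₁.CoveredBy D₂ := by
  have hle : D₁.dir ≤ D₂.dir := fun u v huv => (h u v).2 (.inl huv)
  refine ⟨fun D hD => ?_, fun hd => ?_, fun G hG₁ hG₂ => ?_⟩
  · rw [h₁.represents_iff] at hD
    exact ⟨D₂, h₂.represents_iff.2 rfl, hD ▸ hle⟩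
  · obtain ⟨D, hD, hle'⟩ := hd D₂ (h₂.represents_iff.2 rfl)
    rw [h₁.represents_iff] at hD
    exact hxy (hD ▸ hle' x y ((h x y).2 (.inr ⟨rfl, rfl⟩)))
  · have hG₂' (D : PDAG V) (hD : G.Represents D) : D.dir ≤ D₂.dir := by
      obtain ⟨D', hD', hle'⟩ := hG₂ D hD
      rw [h₂.represents_iff] at hD'
      exact hD' ▸ hle'
    obtain ⟨D, hD, hle'⟩ := hG₁ D₁ (h₁.represents_iff.2 rfl)
    -- The DAGs represented by `G` share one skeleton and all lie in `D₂`, so either all of them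
    -- contain `x → y` or none does.
    by_cases hD₀ : D.dir x y
    · refine .inr fun D' hD' => ⟨D, hD, ?_⟩
      rw [h₂.represents_iff] at hD'
      subst hD'
      intro u v huv
      rcases (h u v).1 huv with h' | ⟨rfl, rfl⟩
      · exact hle' u v h'
      · exact hD₀
    · refine .inl fun D' hD' => ⟨D₁, h₁.represents_iff.2 rfl, fun u v huv => ?_⟩
      refine ((h u v).1 (hG₂' D' hD' u v huv)).resolve_right ?_
      rintro ⟨rfl, rfl⟩
      have : D.skeleton.Adj u v := by rw [hD.2.1, ← hD'.2.1]; exact .inl huv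
      rcases hD.1.skeleton_adj.1 this with h' | h'
      · exact hD₀ h'
      · exact asymm (hG₂' D' hD' u v huv) (hG₂' D hD v u h')

end PDAG

/-! ### Finite patterns and their copies in `V` -/

/-- The edges of a graph with vertices `0, …, n - 1`, some directed and some undirected, that are
compatible with a perfect elimination ordering given by `height` and that contain none of
the forbidden structures. -/
structure Pattern (n : ℕ) where
  height : Fin n → ℕ
  directed : List (Fin n × Fin n)
  undirected : List (Fin n × Fin n)
  height_lt : ∀ q ∈ directed ++ undirected, height q.1 < height q.2 := by decide
  disjoint : ∀ q ∈ directed, q ∉ undirected := by decide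
  clique : ∀ q ∈ directed ++ undirected, ∀ r ∈ directed ++ undirected, q.2 = r.2 → q.1 ≠ r.1 →
    (q.1, r.1) ∈ directed ++ undirected ∨ (r.1, q.1) ∈ directed ++ undirected := by decide
  rule₁ : ∀ q ∈ directed, ∀ k, ((q.2, k) ∈ undirected ∨ (k, q.2) ∈ undirected) → q.1 ≠ k →
    (q.1, k) ∈ directed ++ undirected ∨ (k, q.1) ∈ directed ++ undirected := by decide
  rule₂ : ∀ q ∈ directed, ∀ r ∈ directed, q.2 = r.1 → (q.1, r.2) ∉ undirected := by decide
  rule₄ : ∀ q ∈ directed, ∀ r ∈ directed, ∀ k, q.2 = r.1 →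
    (k, q.1) ∈ undirected ∨ (q.1, k) ∈ undirected →
    (k, r.2) ∈ undirected ∨ (r.2, k) ∈ undirected →
    (q.1, r.2) ∈ directed ++ undirected ∨ (r.2, q.1) ∈ directed ++ undirected := by decide

namespace Pattern

variable {n : ℕ} (E : Pattern n)

/-- Adjacency by a directed or an undirected edge. -/
def Adj (i j : Fin n) : Prop :=
  (i, j) ∈ E.directed ++ E.undirected ∨ (j, i) ∈ E.directed ++ E.undirected

instance (i j : Fin n) : Decidable (E.Adj i j) := by unfold Adj; infer_instance

theorem directed_lt {i j : Fin n} (h : (i, j) ∈ E.directed) : E.height i < E.height j :=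
  E.height_lt (i, j) (List.mem_append_left _ h)

theorem undirected_lt {i j : Fin n} (h : (i, j) ∈ E.undirected) : E.height i < E.height j :=
  E.height_lt (i, j) (List.mem_append_right _ h)

variable {V : Type u} (f : Fin n ↪ V)

/-- The copy of the pattern on the vertices `f 0, …, f (n - 1)`; the other vertices are
isolated. -/
def toPDAG : PDAG V where
  dir x y := ∃ i j, (i, j) ∈ E.directed ∧ f i = x ∧ f j = y
  undir :=
    { Adj := fun x y => ∃ i j, ((i, j) ∈ E.undirected ∨ (j, i) ∈ E.undirected) ∧ f i = x ∧ f j = y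
      symm := ⟨fun _ _ ⟨i, j, h, hx, hy⟩ => ⟨j, i, h.symm, hy, hx⟩⟩
      loopless := ⟨by
        rintro x ⟨i, j, h, hx, hy⟩
        obtain rfl := f.injective (hx.trans hy.symm)
        exact (E.undirected_lt (h.elim id id)).ne rfl⟩ }
  simple := by
    rintro _ _ ⟨i, j, h, rfl, rfl⟩ ⟨i', j', h', hx, hy⟩
    obtain rfl := f.injective hx
    obtain rfl := f.injective hy
    rcases h' with h' | h'
    · exact E.disjoint _ h h'
    · exact (E.directed_lt h).asymm (E.undirected_lt h')
  acyclic x h := by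
    have (y : V) (h : Relation.TransGen
        (fun x y => ∃ i j, (i, j) ∈ E.directed ∧ f i = x ∧ f j = y) x y) :
        ∃ i j, f i = x ∧ f j = y ∧ E.height i < E.height j := by
      induction h with
      | single h =>
        obtain ⟨i, j, h, hx, hy⟩ := h
        exact ⟨i, j, hx, hy, E.directed_lt h⟩
      | tail _ h ih =>
        obtain ⟨i, j, h, hx, hy⟩ := h
        obtain ⟨i', j', hx', hy', h'⟩ := ih
        obtain rfl := f.injective (hx.trans hy'.symm)
        exact ⟨i', j, hx', hy, h'.trans (E.directed_lt h)⟩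
    obtain ⟨i, j, hi, hj, h⟩ := this x h
    obtain rfl := f.injective (hi.trans hj.symm)
    exact h.ne rfl

@[simp]
theorem toPDAG_dir {i j : Fin n} : (E.toPDAG f).dir (f i) (f j) ↔ (i, j) ∈ E.directed := by
  simp [toPDAG]

@[simp]
theorem toPDAG_undir {i j : Fin n} :
    (E.toPDAG f).undir.Adj (f i) (f j) ↔ (i, j) ∈ E.undirected ∨ (j, i) ∈ E.undirected := by
  simp [toPDAG]

theorem exists_of_dir {x y : V} (h : (E.toPDAG f).dir x y) :
    ∃ i j, (i, j) ∈ E.directed ∧ f i = x ∧ f j = y := h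

theorem toPDAG_skeleton {i j : Fin n} : (E.toPDAG f).skeleton.Adj (f i) (f j) ↔ E.Adj i j := by
  simp only [PDAG.skeleton_adj, toPDAG_dir, toPDAG_undir, Adj, List.mem_append]
  tauto

theorem exists_of_skeleton {x y : V} (h : (E.toPDAG f).skeleton.Adj x y) :
    ∃ i j, f i = x ∧ f j = y := by
  rcases h with ⟨i, j, -, hx, hy⟩ | ⟨i, j, -, hx, hy⟩ | ⟨i, j, -, hx, hy⟩
  · exact ⟨i, j, hx, hy⟩
  · exact ⟨j, i, hy, hx⟩
  · exact ⟨i, j, hx, hy⟩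

theorem not_vStructure {x y z : V} : ¬ (E.toPDAG f).VStructure x y z := by
  rintro ⟨⟨i, j, hij, rfl, rfl⟩, ⟨k, l, hkl, rfl, hl⟩, hne, hadj⟩
  obtain rfl := f.injective hl
  exact hadj ((E.toPDAG_skeleton f).2 (E.clique _ (List.mem_append_left _ hij) _
    (List.mem_append_left _ hkl) rfl fun e => hne (congrArg f e)))

/-- `height` and `clique` give a perfect elimination ordering of the skeleton, hence chordality. The
third forbidden structure contains a v-structure, which `clique` excludes; this is why a pattern
needs no separate rule for it. -/
theorem isMPDAG : (E.toPDAG f).IsMPDAG := by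
  refine ⟨fun C => ?_, ?_, ?_, ?_, ?_⟩
  · refine isChordal_of_height (fun x => Function.extend f E.height 0 x) ?_ ?_
    · rintro ⟨x, hx⟩ ⟨y, hy⟩ hxy
      change (E.toPDAG f).skeleton.Adj x y at hxy
      obtain ⟨i, j, rfl, rfl⟩ := E.exists_of_skeleton f hxy
      simp only [f.injective.extend_apply]
      rcases (E.toPDAG_skeleton f).1 hxy with h | h
      · exact (E.height_lt _ h).ne
      · exact (E.height_lt _ h).ne'
    · rintro ⟨x, hx⟩ ⟨y, hy⟩ ⟨z, hz⟩ hxz hyz hx_lt hy_lt hne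
      change (E.toPDAG f).skeleton.Adj x z at hxz
      change (E.toPDAG f).skeleton.Adj y z at hyz
      change (E.toPDAG f).skeleton.Adj x y
      obtain ⟨i, k, rfl, rfl⟩ := E.exists_of_skeleton f hxz
      obtain ⟨j, -, rfl, -⟩ := E.exists_of_skeleton f hyz
      simp only [f.injective.extend_apply] at hx_lt hy_lt
      refine (E.toPDAG_skeleton f).2 (E.clique (i, k) ?_ (j, k) ?_ rfl ?_)
      · exact ((E.toPDAG_skeleton f).1 hxz).resolve_right fun h => (E.height_lt _ h).asymm hx_lt
      · exact ((E.toPDAG_skeleton f).1 hyz).resolve_right fun h => (E.height_lt _ h).asymm hy_lt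
      · exact fun e => hne (Subtype.ext (congrArg f e))
  · rintro ⟨_, _, _, ⟨i, j, hij, rfl, rfl⟩, ⟨j', k, hjk, hj, rfl⟩, hne, hadj⟩
    obtain rfl := f.injective hj
    exact hadj ((E.toPDAG_skeleton f).2 (E.rule₁ _ hij k hjk fun e => hne (congrArg f e)))
  · rintro ⟨_, _, _, ⟨i, j, hij, rfl, rfl⟩, ⟨j', k, hjk, hj, rfl⟩, h⟩
    obtain rfl := f.injective hj
    have hlt := (E.directed_lt hij).trans (E.directed_lt hjk)
    rcases (E.toPDAG_undir f).1 h with h | h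
    · exact E.rule₂ _ hij _ hjk rfl h
    · exact (E.undirected_lt h).asymm hlt
  · rintro ⟨a, b, c, d, -, -, -, h⟩
    exact E.not_vStructure f h
  · rintro ⟨x, _, _, _, hab, -, had, ⟨d, c, hdc, rfl, rfl⟩, ⟨c', b, hcb, hc, rfl⟩, hne, hadj⟩
    obtain rfl := f.injective hc
    obtain ⟨k, l, hkl, rfl, hl⟩ := hab
    obtain rfl := f.injective hl
    exact hadj ((E.toPDAG_skeleton f).2 ((E.rule₄ _ hdc _ hcb k rfl
      ((E.toPDAG_undir f).1 had) hkl).symm))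

/-- The DAGs represented by a copy of a pattern, in terms of their edges. -/
theorem represents_iff {D : PDAG V} : (E.toPDAG f).Represents D ↔ D.IsDAG ∧
    (∀ x y, D.dir x y → ∃ i j, f i = x ∧ f j = y) ∧
    (∀ i j, D.dir (f i) (f j) ∨ D.dir (f j) (f i) ↔ E.Adj i j) ∧
    (∀ q ∈ E.directed, D.dir (f q.1) (f q.2)) ∧
    ∀ i j k, D.dir (f i) (f j) → D.dir (f k) (f j) → i ≠ k → E.Adj i k := by
  constructor
  · intro h
    refine ⟨h.1, fun x y hxy => E.exists_of_skeleton f (h.skeleton_adj.2 (.inl hxy)), fun i j => ?_,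
      fun q hq => h.2.2.1 _ _ ((E.toPDAG_dir f).2 hq), fun i j k hij hkj hne => ?_⟩
    · rw [← h.skeleton_adj, toPDAG_skeleton]
    · by_contra hadj
      refine E.not_vStructure f (h.2.2.2 (f i) (f j) (f k) ⟨hij, hkj, f.injective.ne hne, ?_⟩)
      rwa [h.2.1, toPDAG_skeleton]
  · rintro ⟨hD, hex, hadj, hdir, hv⟩
    refine ⟨hD, ?_, ?_, ?_⟩
    · ext x y
      constructor
      · intro h
        obtain ⟨i, j, rfl, rfl⟩ : ∃ i j, f i = x ∧ f j = y := by
          rcases hD.skeleton_adj.1 h with h | h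
          · exact hex x y h
          · obtain ⟨i, j, hi, hj⟩ := hex y x h
            exact ⟨j, i, hj, hi⟩
        rwa [toPDAG_skeleton, ← hadj, ← hD.skeleton_adj]
      · intro h
        obtain ⟨i, j, rfl, rfl⟩ := E.exists_of_skeleton f h
        rwa [toPDAG_skeleton, ← hadj, ← hD.skeleton_adj] at h
    · rintro _ _ ⟨i, j, hij, rfl, rfl⟩
      exact hdir _ hij
    · rintro x y z ⟨hxy, hzy, hne, hn⟩
      obtain ⟨i, j, rfl, rfl⟩ := hex x y hxy
      obtain ⟨k, -, rfl, -⟩ := hex z _ hzy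
      refine absurd ?_ hn
      rw [hD.skeleton_adj, hadj]
      exact hv i j k hxy hzy fun e => hne (congrArg f e)

end Pattern


/-! ### Criteria for covering and domination -/

namespace PDAG

variable {V : Type u}

/-- If `x → y ← z` occurs in a represented DAG with `x`, `z` not adjacent, then `z → y` in all of
them. -/
theorem Represents.dir_of_collider {G D D' : PDAG V} (hD : G.Represents D) (hD' : G.Represents D')
    {x y z : V} (hxy : D.dir x y) (hzy : D.dir z y) (hxz : x ≠ z) (hadj : ¬ G.skeleton.Adj x z) :
    D'.dir z y :=
  hD'.2.2.1 z y (hD.2.2.2 x y z ⟨hxy, hzy, hxz, by rwa [hD.2.1]⟩).2.1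

end PDAG

namespace Pattern

variable {n : ℕ} {E E₁ E₂ D₀ : Pattern n} {V : Type u} {f : Fin n ↪ V}

theorem isDAG (h : E.undirected = []) : (E.toPDAG f).IsDAG := by
  refine SimpleGraph.ext (funext₂ fun x y => propext (iff_of_false ?_ id))
  rintro ⟨i, j, hij, -, -⟩
  simp [h] at hij

/-- The orientation of all edges of a pattern along its ordering. -/
def oriented (E : Pattern n) : Pattern n where
  height := E.height
  directed := E.directed ++ E.undirected
  undirected := []
  height_lt := by simpa only [List.append_nil] using E.height_lt
  disjoint := by simp
  clique := by simpa only [List.append_nil] using E.clique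
  rule₁ := by simp
  rule₂ := by simp
  rule₄ := by simp

/-- Being a pattern, `D₀` has no v-structure at all, so only adjacencies and directed edges have to
be compared. -/
theorem represents_toPDAG (h₀ : D₀.undirected = []) (hadj : ∀ i j, D₀.Adj i j ↔ E.Adj i j)
    (hd : ∀ q ∈ E.directed, q ∈ D₀.directed) : (E.toPDAG f).Represents (D₀.toPDAG f) := by
  have hD := isDAG (f := f) h₀
  refine (E.represents_iff f).2 ⟨hD, fun x y h => ?_, fun i j => ?_, fun q hq => ?_,
    fun i j k hij hkj hne => ?_⟩
  · obtain ⟨i, j, -, hi, hj⟩ := D₀.exists_of_dir f h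
    exact ⟨i, j, hi, hj⟩
  · rw [← hD.skeleton_adj, toPDAG_skeleton, hadj]
  · exact (D₀.toPDAG_dir f).2 (hd q hq)
  · by_contra hn
    refine D₀.not_vStructure f ⟨hij, hkj, f.injective.ne hne, ?_⟩
    rwa [toPDAG_skeleton, hadj]

theorem exists_represents : ∃ D, (E.toPDAG f).Represents D :=
  ⟨E.oriented.toPDAG f, represents_toPDAG rfl (fun i j => by simp [Adj, oriented])
    fun q hq => List.mem_append_left _ hq⟩

/-- If a single represented DAG contains `j → i`, then orienting `i - j` as `i → j` yields a graph
that is covered by the original one. -/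
theorem coveredBy_of_orient {i j : Fin n} (hadj : ∀ k l, E₁.Adj k l ↔ E₂.Adj k l)
    (hd : ∀ q, q ∈ E₁.directed ↔ q ∈ E₂.directed ∨ q = (i, j))
    (h₀ : D₀.undirected = []) (hadj₀ : ∀ k l, D₀.Adj k l ↔ E₂.Adj k l)
    (hd₀ : ∀ q ∈ E₂.directed, q ∈ D₀.directed) (hji : (j, i) ∈ D₀.directed)
    (h : ∀ D, (E₂.toPDAG f).Represents D → D.dir (f j) (f i) →
      ∀ q ∈ D₀.directed, D.dir (f q.1) (f q.2)) :
    (E₁.toPDAG f).CoveredBy (E₂.toPDAG f) := by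
  -- The represented DAGs of `E₂` split by the direction of `i - j`: those with `i → j` are the ones
  -- of `E₁`, and `h` leaves only `D₀` for the other direction.
  have hiff (D : PDAG V) : (E₁.toPDAG f).Represents D ↔
      (E₂.toPDAG f).Represents D ∧ D.dir (f i) (f j) := by
    simp only [represents_iff, hadj, hd, or_imp, forall_and, forall_eq]
    tauto
  have hrep : (E₂.toPDAG f).Represents (D₀.toPDAG f) := represents_toPDAG h₀ hadj₀ hd₀
  have hij : E₂.Adj i j := by
    rw [← hadj]
    exact .inl (List.mem_append_left _ ((hd _).2 (.inr rfl)))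
  refine PDAG.coveredBy_of_insert (D₀ := D₀.toPDAG f) ?_ exists_represents
    (fun D hD => ((hiff D).1 hD).1) hrep (fun hD => ?_) fun D hD => ?_
  · ext x y
    constructor <;> intro hxy <;> obtain ⟨k, l, rfl, rfl⟩ := exists_of_skeleton _ _ hxy <;>
      simpa only [toPDAG_skeleton, hadj] using hxy
  · exact PDAG.asymm ((hiff _).1 hD).2 ((D₀.toPDAG_dir f).2 hji)
  · rw [hiff]
    rcases (((E₂.represents_iff f).1 hD).2.2.1 i j).2 hij with h' | h'
    · exact .inl ⟨hD, h'⟩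
    · refine .inr (Eq.symm (hrep.1.eq_of_le hD.1 ?_ fun x y hxy => by rwa [hrep.2.1, ← hD.2.1]))
      rintro _ _ ⟨k, l, hkl, rfl, rfl⟩
      exact h D hD h' _ hkl

theorem coveredBy_of_add {i j : Fin n} (h₁ : E₁.undirected = []) (h₂ : E₂.undirected = [])
    (hij : (i, j) ∉ E₁.directed) (h : ∀ q, q ∈ E₂.directed ↔ q ∈ E₁.directed ∨ q = (i, j)) :
    (E₁.toPDAG f).CoveredBy (E₂.toPDAG f) := by
  refine (isDAG h₁).coveredBy (isDAG h₂) (x := f i) (y := f j) (by simpa using hij) fun x y => ?_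
  constructor
  · rintro ⟨k, l, hkl, rfl, rfl⟩
    rcases (h _).1 hkl with h' | h'
    · exact .inl ⟨k, l, h', rfl, rfl⟩
    · obtain ⟨rfl, rfl⟩ := Prod.mk.inj h'
      exact .inr ⟨rfl, rfl⟩
  · rintro (⟨k, l, hkl, rfl, rfl⟩ | ⟨rfl, rfl⟩)
    · exact ⟨k, l, (h _).2 (.inl hkl), rfl, rfl⟩
    · exact ⟨i, j, (h _).2 (.inr rfl), rfl, rfl⟩

theorem exists_dominating {G : PDAG V} (hG : (E.toPDAG f).Dominated G) (D₀ : Pattern n)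
    (h₀ : D₀.undirected = []) (hadj : ∀ i j, D₀.Adj i j ↔ E.Adj i j)
    (hd : ∀ q ∈ E.directed, q ∈ D₀.directed) :
    ∃ D, G.Represents D ∧ ∀ q ∈ D₀.directed, D.dir (f q.1) (f q.2) := by
  obtain ⟨D, hD, hle⟩ := hG _ (represents_toPDAG h₀ hadj hd)
  exact ⟨D, hD, fun q hq => hle _ _ ((D₀.toPDAG_dir f).2 hq)⟩

theorem skeleton_of_dominated {G : PDAG V} (hne : ∃ D, G.Represents D)
    (hG : G.Dominated (E.toPDAG f)) {x y : V} (hxy : G.skeleton.Adj x y) :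
    ∃ i j, E.Adj i j ∧ f i = x ∧ f j = y := by
  obtain ⟨D, hD⟩ := hne
  obtain ⟨D', hD', hle⟩ := hG D hD
  have h : (E.toPDAG f).skeleton.Adj x y := by
    rw [← hD'.2.1]
    exact PDAG.skeleton_mono hD.1 hle (by rwa [hD.2.1])
  obtain ⟨i, j, rfl, rfl⟩ := E.exists_of_skeleton f h
  exact ⟨i, j, (E.toPDAG_skeleton f).1 h, rfl, rfl⟩

theorem skeleton_of_dominating {G : PDAG V} (hG : (E.toPDAG f).Dominated G) {i j : Fin n}
    (hij : E.Adj i j) : G.skeleton.Adj (f i) (f j) := by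
  obtain ⟨D, hD⟩ := exists_represents (E := E) (f := f)
  obtain ⟨D', hD', hle⟩ := hG D hD
  rw [← hD'.2.1]
  exact PDAG.skeleton_mono hD.1 hle (by rwa [hD.2.1, toPDAG_skeleton])

/-- A graph between `E₁` and `E₂` without the edges that `E₂` adds to `E₁` is dominated by `E₁`. -/
theorem dominated_of_not_adj {G : PDAG V} (hne : ∃ D, G.Represents D)
    (hG : G.Dominated (E₂.toPDAG f)) (hG₁ : (E₁.toPDAG f).Dominated G)
    (hn : ∀ i j, E₂.Adj i j → ¬ E₁.Adj i j → ¬ G.skeleton.Adj (f i) (f j))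
    (hd : E₁.directed = [])
    (h : ∀ i j k, E₁.Adj i j → E₁.Adj k j → i ≠ k → E₂.Adj i k → E₁.Adj i k) :
    G.Dominated (E₁.toPDAG f) := by
  have hs (x y : V) (hxy : G.skeleton.Adj x y) : ∃ i j, E₁.Adj i j ∧ f i = x ∧ f j = y := by
    obtain ⟨i, j, hij, rfl, rfl⟩ := skeleton_of_dominated hne hG hxy
    exact ⟨i, j, by_contra fun h => hn i j hij h hxy, rfl, rfl⟩
  have hs' (i j : Fin n) : G.skeleton.Adj (f i) (f j) ↔ E₁.Adj i j := by
    refine ⟨fun hij => ?_, skeleton_of_dominating hG₁⟩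
    obtain ⟨k, l, hkl, hk, hl⟩ := hs _ _ hij
    rwa [← f.injective hk, ← f.injective hl]
  intro D hD
  obtain ⟨D', hD', hle⟩ := hG D hD
  refine ⟨D, (E₁.represents_iff f).2 ⟨hD.1, fun x y hxy => ?_, fun i j => ?_, ?_,
    fun i j k hij hkj hne => ?_⟩, le_rfl⟩
  · obtain ⟨i, j, -, hi, hj⟩ := hs x y (hD.skeleton_adj.2 (.inl hxy))
    exact ⟨i, j, hi, hj⟩
  · rw [← hD.skeleton_adj, hs']
  · simp [hd]
  -- A collider of `D` is also one of `D'`, so its tails are adjacent in `E₂`.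
  · refine h i j k ?_ ?_ hne
      (((E₂.represents_iff f).1 hD').2.2.2.2 i j k (hle _ _ hij) (hle _ _ hkj) hne)
    · exact (hs' i j).1 (hD.skeleton_adj.2 (.inl hij))
    · exact (hs' k j).1 (hD.skeleton_adj.2 (.inl hkj))

/-- A graph below `E` with all edges of `E` dominates `E` if both orientations of every undirected
edge of `E` occur in DAGs that it represents. -/
theorem dominated_of_occurs {G : PDAG V} (hne : ∃ D, G.Represents D)
    (hG : G.Dominated (E.toPDAG f)) (hs : ∀ i j, E.Adj i j → G.skeleton.Adj (f i) (f j))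
    (h : ∀ q ∈ E.undirected, (∃ D, G.Represents D ∧ D.dir (f q.1) (f q.2)) ∧
      ∃ D, G.Represents D ∧ D.dir (f q.2) (f q.1)) :
    (E.toPDAG f).Dominated G := by
  refine fun D hD => ⟨D, ⟨hD.1, ?_, ?_, ?_⟩, le_rfl⟩
  · ext x y
    rw [hD.2.1]
    constructor <;> intro hxy
    · obtain ⟨i, j, rfl, rfl⟩ := E.exists_of_skeleton f hxy
      exact hs i j ((E.toPDAG_skeleton f).1 hxy)
    · obtain ⟨i, j, hij, rfl, rfl⟩ := skeleton_of_dominated hne hG hxy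
      exact (E.toPDAG_skeleton f).2 hij
  · intro x y hxy
    obtain ⟨i, j, hij, rfl, rfl⟩ := skeleton_of_dominated hne hG (.inl hxy)
    -- A directed edge of `G` has the same direction in all its DAGs, so it cannot be an undirected
    -- edge of `E`, for which both directions occur.
    have hno {D' : PDAG V} (hD' : G.Represents D') (hd : D'.dir (f j) (f i)) : False :=
      PDAG.asymm (hD'.2.2.1 _ _ hxy) hd
    simp only [Adj, List.mem_append] at hij
    rcases hij with (hij | hij) | hij | hij
    · exact hD.2.2.1 _ _ ((E.toPDAG_dir f).2 hij)
    · obtain ⟨-, D', hD', hd⟩ := h _ hij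
      exact (hno hD' hd).elim
    · obtain ⟨D', hD'⟩ := hne
      obtain ⟨D'', hD'', hle⟩ := hG D' hD'
      exact (PDAG.asymm (hle _ _ (hD'.2.2.1 _ _ hxy))
        (hD''.2.2.1 _ _ ((E.toPDAG_dir f).2 hij))).elim
    · obtain ⟨⟨D', hD', hd⟩, -⟩ := h _ hij
      exact (hno hD' hd).elim
  · rintro x y z ⟨hxy, hzy, hxz, hadj⟩
    obtain ⟨i, j, rfl, rfl⟩ := E.exists_of_skeleton f (hD.skeleton_adj.2 (.inl hxy))
    obtain ⟨k, -, rfl, -⟩ := E.exists_of_skeleton f (hD.skeleton_adj.2 (.inl hzy))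
    refine absurd ?_ hadj
    rw [hD.2.1, toPDAG_skeleton]
    exact ((E.represents_iff f).1 hD).2.2.2.2 i j k hxy hzy fun e => hxz (congrArg f e)


variable {n : ℕ} {E : Pattern n} {V : Type u} {f : Fin n ↪ V}

theorem adj_of_represents {D : PDAG V} (hD : (E.toPDAG f).Represents D) (i j : Fin n)
    (h : E.Adj i j) : D.dir (f i) (f j) ∨ D.dir (f j) (f i) :=
  (((E.represents_iff f).1 hD).2.2.1 i j).2 h

theorem dir_of_represents {D : PDAG V} (hD : (E.toPDAG f).Represents D) (i j : Fin n)
    (h : (i, j) ∈ E.directed) : D.dir (f i) (f j) :=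
  ((E.represents_iff f).1 hD).2.2.2.1 _ h

/-- The reverse direction would make `j` a collider with nonadjacent tails. Together with
`dir_of_path`, which uses acyclicity, this propagates the choice of one orientation to further
edges. -/
theorem dir_of_not_adj {D : PDAG V} (hD : (E.toPDAG f).Represents D) (i j k : Fin n)
    (hij : D.dir (f i) (f j)) (hne : i ≠ k) (hik : ¬ E.Adj i k) (hkj : E.Adj j k) :
    D.dir (f j) (f k) :=
  (adj_of_represents hD j k hkj).resolve_right fun h =>
    hik (((E.represents_iff f).1 hD).2.2.2.2 i j k hij h hne)

theorem dir_of_path {D : PDAG V} (hD : (E.toPDAG f).Represents D) (i j k : Fin n)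
    (hij : D.dir (f i) (f j)) (hjk : D.dir (f j) (f k)) (hik : E.Adj i k) : D.dir (f i) (f k) :=
  (adj_of_represents hD i k hik).resolve_right (PDAG.no_triangle hij hjk)

/-! ### The graphs on three and four vertices -/

/-- `1 → 2`. -/
def arrow : Pattern 3 where
  height := ![0, 1, 2]
  directed := [(1, 2)]
  undirected := []

/-- `1 - 2`. -/
def edge : Pattern 3 where
  height := ![0, 1, 2]
  directed := []
  undirected := [(1, 2)]

/-- `0 → 1`, `0 → 2`, `1 - 2`. -/
def cone : Pattern 3 where
  height := ![0, 1, 2]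
  directed := [(0, 1), (0, 2)]
  undirected := [(1, 2)]

/-- `0 → 1`, `1 → 2`. -/
def diPath : Pattern 3 where
  height := ![0, 1, 2]
  directed := [(0, 1), (1, 2)]
  undirected := []

/-- `0 → 1`, `1 → 2`, `0 → 2`. -/
def diTriangle : Pattern 3 where
  height := ![0, 1, 2]
  directed := [(0, 1), (1, 2), (0, 2)]
  undirected := []

/-- `2 → 1`. -/
def arrowRev : Pattern 3 where
  height := ![0, 1, 0]
  directed := [(2, 1)]
  undirected := []

/-- `0 → 1`, `0 → 2`, `2 → 1`. -/
def diTriangleRev : Pattern 3 where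
  height := ![0, 2, 1]
  directed := [(0, 1), (0, 2), (2, 1)]
  undirected := []

/-- `0 → 1`, `1 → 3`. -/
def path : Pattern 4 where
  height := ![0, 1, 2, 3]
  directed := [(0, 1), (1, 3)]
  undirected := []

/-- `1 → 3`, `0 - 1`. -/
def semiPath : Pattern 4 where
  height := ![0, 1, 2, 3]
  directed := [(1, 3)]
  undirected := [(0, 1)]

/-- `0 - 1`, `1 - 3`. -/
def undirPath : Pattern 4 where
  height := ![0, 1, 2, 3]
  directed := []
  undirected := [(0, 1), (1, 3)]

/-- `2 → 3`, `0 - 1`, `1 - 2`, `1 - 3`. -/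
def paw : Pattern 4 where
  height := ![0, 1, 2, 3]
  directed := [(2, 3)]
  undirected := [(0, 1), (1, 2), (1, 3)]

/-- `0 → 1`, `1 → 2`, `1 → 3`. -/
def fork : Pattern 4 where
  height := ![0, 1, 2, 3]
  directed := [(0, 1), (1, 2), (1, 3)]
  undirected := []

/-- `0 → 1`, `1 → 2`, `1 → 3`, `2 → 3`. -/
def diPaw : Pattern 4 where
  height := ![0, 1, 2, 3]
  directed := [(0, 1), (1, 2), (1, 3), (2, 3)]
  undirected := []

/-- `1 → 2`, `1 → 3`, `2 → 3`, `0 - 1`. -/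
def pawTail : Pattern 4 where
  height := ![0, 1, 2, 3]
  directed := [(1, 2), (1, 3), (2, 3)]
  undirected := [(0, 1)]

/-- `1 → 3`, `2 → 3`, `0 - 1`, `1 - 2`. -/
def pawPath : Pattern 4 where
  height := ![0, 1, 2, 3]
  directed := [(1, 3), (2, 3)]
  undirected := [(0, 1), (1, 2)]

/-- `1 → 0`, `1 → 3`. -/
def pathOut : Pattern 4 where
  height := ![1, 0, 2, 3]
  directed := [(1, 0), (1, 3)]
  undirected := []

/-- `3 → 1`, `1 → 0`. -/
def pathRev : Pattern 4 where
  height := ![2, 1, 0, 0]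
  directed := [(3, 1), (1, 0)]
  undirected := []

/-- `1 → 0`, `1 → 2`, `1 → 3`, `2 → 3`. -/
def pawTop : Pattern 4 where
  height := ![1, 0, 2, 3]
  directed := [(1, 0), (1, 2), (1, 3), (2, 3)]
  undirected := []

/-- `2 → 1`, `1 → 3`, `2 → 3`, `1 → 0`. -/
def pawMid : Pattern 4 where
  height := ![3, 1, 0, 2]
  directed := [(2, 1), (1, 3), (2, 3), (1, 0)]
  undirected := []

/-- `3 → 1`, `2 → 1`, `2 → 3`, `1 → 0`. -/
def pawBot : Pattern 4 where
  height := ![3, 2, 0, 1]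
  directed := [(3, 1), (2, 1), (2, 3), (1, 0)]
  undirected := []

/-! ### Covers that undirect one edge or add one edge -/

variable (f : Fin 3 ↪ V) (g : Fin 4 ↪ V)

theorem arrow_edge : (arrow.toPDAG f).CoveredBy (edge.toPDAG f) := by
  refine coveredBy_of_orient (D₀ := arrowRev) (i := 1) (j := 2) (by decide) (by decide) rfl
    (by decide) (by decide) (by decide) fun D hD h => ?_
  simp [arrowRev, h]

theorem diTriangle_cone : (diTriangle.toPDAG f).CoveredBy (cone.toPDAG f) := by
  refine coveredBy_of_orient (D₀ := diTriangleRev) (i := 1) (j := 2) (by decide) (by decide) rfl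
    (by decide) (by decide) (by decide) fun D hD h => ?_
  have h₁ := dir_of_represents hD 0 1 (by decide)
  have h₂ := dir_of_represents hD 0 2 (by decide)
  simp [diTriangleRev, h, h₁, h₂]

theorem arrow_diPath : (arrow.toPDAG f).CoveredBy (diPath.toPDAG f) :=
  coveredBy_of_add (i := 0) (j := 1) rfl rfl (by decide) (by simp [arrow, diPath, or_comm])

theorem diPath_diTriangle : (diPath.toPDAG f).CoveredBy (diTriangle.toPDAG f) :=
  coveredBy_of_add (i := 0) (j := 2) rfl rfl (by decide) (by simp [diTriangle, diPath, or_assoc])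

theorem path_semiPath : (path.toPDAG g).CoveredBy (semiPath.toPDAG g) := by
  refine coveredBy_of_orient (D₀ := pathOut) (i := 0) (j := 1) (by decide) (by decide) rfl
    (by decide) (by decide) (by decide) fun D hD h => ?_
  have h₁ := dir_of_represents hD 1 3 (by decide)
  simp [pathOut, h, h₁]

theorem semiPath_undirPath : (semiPath.toPDAG g).CoveredBy (undirPath.toPDAG g) := by
  refine coveredBy_of_orient (D₀ := pathRev) (i := 1) (j := 3) (by decide) (by decide) rfl
    (by decide) (by decide) (by decide) fun D hD h => ?_
  have h₁ := dir_of_not_adj hD 3 1 0 h (by decide) (by decide) (by decide)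
  simp [pathRev, h, h₁]

theorem path_fork : (path.toPDAG g).CoveredBy (fork.toPDAG g) :=
  coveredBy_of_add (i := 1) (j := 2) rfl rfl (by decide) (by decide)

theorem fork_diPaw : (fork.toPDAG g).CoveredBy (diPaw.toPDAG g) :=
  coveredBy_of_add (i := 2) (j := 3) rfl rfl (by decide) (by decide)

theorem diPaw_pawTail : (diPaw.toPDAG g).CoveredBy (pawTail.toPDAG g) := by
  refine coveredBy_of_orient (D₀ := pawTop) (i := 0) (j := 1) (by decide) (by decide) rfl
    (by decide) (by decide) (by decide) fun D hD h => ?_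
  have h₁ := dir_of_represents hD 1 2 (by decide)
  have h₂ := dir_of_represents hD 1 3 (by decide)
  have h₃ := dir_of_represents hD 2 3 (by decide)
  simp [pawTop, h, h₁, h₂, h₃]

theorem pawTail_pawPath : (pawTail.toPDAG g).CoveredBy (pawPath.toPDAG g) := by
  refine coveredBy_of_orient (D₀ := pawMid) (i := 1) (j := 2) (by decide) (by decide) rfl
    (by decide) (by decide) (by decide) fun D hD h => ?_
  have h₁ := dir_of_represents hD 1 3 (by decide)
  have h₂ := dir_of_represents hD 2 3 (by decide)
  have h₃ := dir_of_not_adj hD 2 1 0 h (by decide) (by decide) (by decide)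
  simp [pawMid, h, h₁, h₂, h₃]

/-- Once `3 → 1` is chosen, acyclicity forces `2 → 1` and the absence of `0 - 3` forces `1 → 0`, so
a single DAG is gained. -/
theorem pawPath_paw : (pawPath.toPDAG g).CoveredBy (paw.toPDAG g) := by
  refine coveredBy_of_orient (D₀ := pawBot) (i := 1) (j := 3) (by decide) (by decide) rfl
    (by decide) (by decide) (by decide) fun D hD h => ?_
  have h₁ := dir_of_represents hD 2 3 (by decide)
  have h₂ := dir_of_path hD 2 3 1 h₁ h (by decide)
  have h₃ := dir_of_not_adj hD 3 1 0 h (by decide) (by decide) (by decide)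
  simp [pawBot, h, h₁, h₂, h₃]

end Pattern

/-! ### Covers that add two edges at once -/

theorem PDAG.Represents.dir_of_le {V : Type u} {G D D' : PDAG V} (hD : G.Represents D)
    (hle : D.dir ≤ D'.dir) {x y : V} (hxy : G.skeleton.Adj x y) (h : D'.dir x y) : D.dir x y :=
  (hD.skeleton_adj.1 hxy).resolve_right fun h' => PDAG.asymm h (hle _ _ h')

namespace Pattern

variable {n : ℕ} {E E₁ E₂ : Pattern n} {V : Type u} {f : Fin n ↪ V}

theorem le_toPDAG {D : PDAG V} (hD : (E.toPDAG f).Represents D) (D₀ : Pattern n)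
    (h₀ : D₀.undirected = []) (hadj : ∀ i j, E.Adj i j → D₀.Adj i j)
    (h : ∀ q ∈ D₀.directed, E.Adj q.1 q.2 → D.dir (f q.1) (f q.2)) :
    D.dir ≤ (D₀.toPDAG f).dir := by
  intro x y hxy
  obtain ⟨-, hex, hD', -⟩ := (E.represents_iff f).1 hD
  obtain ⟨i, j, rfl, rfl⟩ := hex x y hxy
  have hij := hadj i j ((hD' i j).1 (.inl hxy))
  simp only [Adj, h₀, List.append_nil] at hij
  rcases hij with hij | hij
  · exact (D₀.toPDAG_dir f).2 hij
  · exact (PDAG.asymm hxy (h _ hij ((hD' j i).1 (.inr hxy)))).elim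

theorem adj_of_dominated (h : (E₁.toPDAG f).Dominated (E₂.toPDAG f)) (i j : Fin n)
    (hij : E₁.Adj i j) : E₂.Adj i j :=
  (E₂.toPDAG_skeleton f).1 (skeleton_of_dominating h hij)

/-- An intermediate `G` represents DAGs with `1 → 2` and with `2 → 1`. With `0 - 1` but not `0 - 2`
in its skeleton, the unshielded collider `0 → 1 ← 2` would fix `2 → 1` in all of them; the other
case is symmetric. So `G` has both new edges or neither. -/
theorem edge_cone (f : Fin 3 ↪ V) : (edge.toPDAG f).CoveredBy (cone.toPDAG f) := by
  refine ⟨fun D hD => ?_, fun h => ?_, fun G h₁ h₂ => ?_⟩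
  · rcases adj_of_represents hD 1 2 (by decide) with h | h
    · refine ⟨_, represents_toPDAG (D₀ := diTriangle) rfl (by decide) (by decide),
        le_toPDAG hD _ rfl (by decide) ?_⟩
      simp [diTriangle, h, Adj, edge]
    · refine ⟨_, represents_toPDAG (D₀ := diTriangleRev) rfl (by decide) (by decide),
        le_toPDAG hD _ rfl (by decide) ?_⟩
      simp [diTriangleRev, h, Adj, edge]
  · exact absurd (adj_of_dominated h 0 1 (by decide)) (by decide)
  · obtain ⟨D, hD, hd⟩ := exists_dominating h₁ arrow rfl (by decide) (by decide)
    obtain ⟨D', hD', hd'⟩ := exists_dominating h₁ arrowRev rfl (by decide) (by decide)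
    replace hd := hd (1, 2) (by decide)
    replace hd' := hd' (2, 1) (by decide)
    obtain ⟨T, hT, hle⟩ := h₂ D hD
    obtain ⟨T', hT', hle'⟩ := h₂ D' hD'
    by_cases h01 : G.skeleton.Adj (f 0) (f 1) <;> by_cases h02 : G.skeleton.Adj (f 0) (f 2)
    · refine .inr (dominated_of_occurs ⟨D, hD⟩ h₂ ?_ ?_)
      · have h12 : G.skeleton.Adj (f 1) (f 2) := hD.skeleton_adj.2 (.inl hd)
        intro i j hij
        fin_cases i <;> fin_cases j <;> first
          | exact absurd hij (by decide)
          | assumption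
          | exact SimpleGraph.Adj.symm ‹_›
      · simp only [cone, List.mem_singleton, forall_eq]
        exact ⟨⟨D, hD, hd⟩, D', hD', hd'⟩
    · have h := hD'.dir_of_le hle' h01 (dir_of_represents hT' 0 1 (by decide))
      exact (PDAG.asymm hd (hD'.dir_of_collider hD h hd' (by simp) h02)).elim
    · have h := hD.dir_of_le hle h02 (dir_of_represents hT 0 2 (by decide))
      exact (PDAG.asymm hd' (hD.dir_of_collider hD' h hd (by simp) h01)).elim
    · refine .inl (dominated_of_not_adj ⟨D, hD⟩ h₂ h₁ ?_ rfl (by decide))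
      intro i j hij hij'
      fin_cases i <;> fin_cases j <;> first
        | exact absurd hij (by decide)
        | exact absurd (by decide) hij'
        | assumption
        | exact fun h => absurd h.symm ‹_›

/-- An intermediate `G` represents DAGs containing `0 → 1 → 3` and `3 → 1 → 0`. Having `1 - 2`
without `2 - 3` gives the collider `2 → 1 ← 3`, which rules out `1 → 3`; having `2 - 3` without `1 -
2` gives `1 → 3 ← 2`, which rules out `3 → 1`. With both edges, `1 - 2` also occurs in both
directions. -/
theorem undirPath_paw (f : Fin 4 ↪ V) : (undirPath.toPDAG f).CoveredBy (paw.toPDAG f) := by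
  refine ⟨fun D hD => ?_, fun h => ?_, fun G h₁ h₂ => ?_⟩
  · rcases adj_of_represents hD 1 3 (by decide) with h | h
    · rcases adj_of_represents hD 0 1 (by decide) with h' | h'
      · refine ⟨_, represents_toPDAG (D₀ := diPaw) rfl (by decide) (by decide),
          le_toPDAG hD _ rfl (by decide) ?_⟩
        simp [diPaw, h, h', Adj, undirPath]
      · refine ⟨_, represents_toPDAG (D₀ := pawTop) rfl (by decide) (by decide),
          le_toPDAG hD _ rfl (by decide) ?_⟩
        simp [pawTop, h, h', Adj, undirPath]
    · have h' := dir_of_not_adj hD 3 1 0 h (by decide) (by decide) (by decide)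
      refine ⟨_, represents_toPDAG (D₀ := pawBot) rfl (by decide) (by decide),
        le_toPDAG hD _ rfl (by decide) ?_⟩
      simp [pawBot, h, h', Adj, undirPath]
  · exact absurd (adj_of_dominated h 1 2 (by decide)) (by decide)
  · obtain ⟨D, hD, hd⟩ := exists_dominating h₁ path rfl (by decide) (by decide)
    obtain ⟨D', hD', hd'⟩ := exists_dominating h₁ pathRev rfl (by decide) (by decide)
    have h01 := hd (0, 1) (by decide)
    have h13 := hd (1, 3) (by decide)
    have h31 := hd' (3, 1) (by decide)
    have h10 := hd' (1, 0) (by decide)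
    obtain ⟨T, hT, hle⟩ := h₂ D hD
    obtain ⟨T', hT', hle'⟩ := h₂ D' hD'
    have t12 := dir_of_not_adj hT 0 1 2 (hle _ _ h01) (by decide) (by decide) (by decide)
    have t21 := dir_of_path hT' 2 3 1 (dir_of_represents hT' 2 3 (by decide)) (hle' _ _ h31)
      (by decide)
    by_cases a12 : G.skeleton.Adj (f 1) (f 2) <;> by_cases a23 : G.skeleton.Adj (f 2) (f 3)
    · refine .inr (dominated_of_occurs ⟨D, hD⟩ h₂ ?_ ?_)
      · have a01 : G.skeleton.Adj (f 0) (f 1) := hD.skeleton_adj.2 (.inl h01)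
        have a13 : G.skeleton.Adj (f 1) (f 3) := hD.skeleton_adj.2 (.inl h13)
        intro i j hij
        fin_cases i <;> fin_cases j <;> first
          | exact absurd hij (by decide)
          | assumption
          | exact SimpleGraph.Adj.symm ‹_›
      · simp only [paw, List.forall_mem_cons, List.not_mem_nil, false_imp_iff, implies_true]
        exact ⟨⟨⟨D, hD, h01⟩, D', hD', h10⟩, ⟨⟨D, hD, hD.dir_of_le hle a12 t12⟩,
          D', hD', hD'.dir_of_le hle' a12.symm t21⟩, ⟨⟨D, hD, h13⟩, D', hD', h31⟩, trivial⟩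
    · have h := hD'.dir_of_le hle' a12.symm t21
      exact (PDAG.asymm h13 (hD'.dir_of_collider hD h h31 (by simp) a23)).elim
    · have h := hD.dir_of_le hle a23 (dir_of_represents hT 2 3 (by decide))
      exact (PDAG.asymm h31 (hD.dir_of_collider hD' h h13 (by simp) fun h => a12 h.symm)).elim
    · refine .inl (dominated_of_not_adj ⟨D, hD⟩ h₂ h₁ ?_ rfl (by decide))
      intro i j hij hij'
      fin_cases i <;> fin_cases j <;> first
        | exact absurd hij (by decide)
        | exact absurd (by decide) hij'
        | assumption
        | exact fun h => absurd h.symm ‹_›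

/-- The MPDAG given by a copy of a pattern. -/
def toMPDAG (E : Pattern n) (f : Fin n ↪ V) (𝒳 : V → Type w) : CausalMPDAG 𝒳 :=
  ⟨E.toPDAG f, E.isMPDAG f⟩

end Pattern

end CausalGraph

/-! ### Chains of different lengths -/

open CausalGraph Pattern in
theorem proposition4p9 {V : Type*} [Fintype V] (hV : 3 ≤ Fintype.card V)
    (𝒳 : V → Type*) [∀ v, MeasurableSpace (𝒳 v)] [∀ v, MeasurableSingletonClass (𝒳 v)]
    [∀ v, Nontrivial (𝒳 v)] :
    (¬ ∃ rank : CausalGraph.CausalMPDAG 𝒳 → ℤ,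
        ∀ G₁ G₂ : CausalGraph.CausalMPDAG 𝒳, G₁ ⋖ G₂ → rank G₂ = rank G₁ + 1) ∧
      (4 ≤ Fintype.card V →
        ∃ p q : RelSeries {(G₁, G₂) : CausalGraph.CausalMPDAG 𝒳 × CausalGraph.CausalMPDAG 𝒳 |
            G₁ ⋖ G₂},
          p.head = q.head ∧ p.last = q.last ∧ p.length = 3 ∧ q.length = 5) := by
  have : Nonempty V := Fintype.card_pos_iff.1 (by lia)
  constructor
  · rintro ⟨rank, h⟩
    obtain ⟨f⟩ : Nonempty (Fin 3 ↪ V) :=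
      Function.Embedding.nonempty_of_card_le (by simpa using hV)
    -- Between `arrow` and `cone` the rank would increase by two along one chain and by three along
    -- the other.
    have h₁ := h (arrow.toMPDAG f 𝒳) (edge.toMPDAG f 𝒳) (arrow_edge f).covBy
    have h₂ := h (edge.toMPDAG f 𝒳) (cone.toMPDAG f 𝒳) (edge_cone f).covBy
    have h₃ := h (arrow.toMPDAG f 𝒳) (diPath.toMPDAG f 𝒳) (arrow_diPath f).covBy
    have h₄ := h (diPath.toMPDAG f 𝒳) (diTriangle.toMPDAG f 𝒳) (diPath_diTriangle f).covBy
    have h₅ := h (diTriangle.toMPDAG f 𝒳) (cone.toMPDAG f 𝒳) (diTriangle_cone f).covBy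
    lia
  · intro hV₄
    obtain ⟨f⟩ : Nonempty (Fin 4 ↪ V) :=
      Function.Embedding.nonempty_of_card_le (by simpa using hV₄)
    let p : Fin 4 → CausalMPDAG 𝒳 := ![path.toMPDAG f 𝒳, semiPath.toMPDAG f 𝒳,
      undirPath.toMPDAG f 𝒳, paw.toMPDAG f 𝒳]
    let q : Fin 6 → CausalMPDAG 𝒳 := ![path.toMPDAG f 𝒳, fork.toMPDAG f 𝒳, diPaw.toMPDAG f 𝒳,
      pawTail.toMPDAG f 𝒳, pawPath.toMPDAG f 𝒳, paw.toMPDAG f 𝒳]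
    refine ⟨⟨3, p, fun i => ?_⟩, ⟨5, q, fun i => ?_⟩, rfl, rfl, rfl, rfl⟩
    · fin_cases i
      · exact (path_semiPath f).covBy
      · exact (semiPath_undirPath f).covBy
      · exact (undirPath_paw f).covBy
    · fin_cases i
      · exact (path_fork f).covBy
      · exact (fork_diPaw f).covBy
      · exact (diPaw_pawTail f).covBy
      · exact (pawTail_pawPath f).covBy
      · exact (pawPath_paw f).covBy
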